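/- Let $M$ be a smooth ($C^\infty$, Hausdorff, boundaryless, finite-dimensional) manifold with an almost contact metric structure $(\phi,\xi,\eta,g)$, that is, a smooth $(1,1)$-tensor field $\phi$, a smooth vector field $\xi$, a smooth $1$-form $\eta$ and a smooth Riemannian metric $g$ such that, for all smooth vector fields $X,Y$ on $M$, $$\phi^2X=-X+\eta(X)\xi,\quad \phi\xi=0,\quad \eta\circ\phi=0,\quad \eta(\xi)=1,\quad g(\phi X,\phi Y)=g(X,Y)-\eta(X)\eta(Y),\quad \eta(X)=g(\xi,X)$$ (so $\dim M$ is odd). Let $\nabla$ be the Levi-Civita connection of $g$ and $h=\tfrac12 L_\xi\phi$, that is, $hX=\tfrac12([\xi,\phi X]-\phi[\xi,X])$. Endow $\bar M=M\times\mathbb R$, with $t$ the coordinate of $\mathbb R$, with the almost Hermitian structure $(\bar J,\bar g)$ given by $$\bar JX=\phi X-\eta(X)\tfrac{\partial}{\partial t},\qquad \bar J\tfrac{\partial}{\partial t}=\xi,\qquad \bar g=e^{-2t}(g+dt^2)$$ for $X$ tangent to $M$, and let $\bar\nabla$ be the Levi-Civita connection of $\bar g$. Call $(M,\phi,\xi,\eta,g)$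 a quasi contact metric manifold if $(\bar M,\bar J,\bar g)$ is quasi-Kähler, that is, if $(\bar\nabla_U\bar J)V+(\bar\nabla_{\bar JU}\bar J)\bar JV=0$ for all smooth vector fields $U,V$ on $\bar M$. Then $(M,\phi,\xi,\eta,g)$ is a quasi contact metric manifold if and only if it satisfies the condition $$(C_1)\qquad (\nabla_X\phi)Y+(\nabla_{\phi X}\phi)\phi Y=2g(X,Y)\xi-\eta(Y)X-\eta(X)\eta(Y)\xi-\eta(Y)hX$$ for all smooth vector fields $X,Y$ on $M$. -/

import Mathlib

open Bundle VectorField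
open scoped Manifold ContDiff Topology

noncomputable section

section LeviCivita

variable {E : Type*} [NormedAddCommGroup E] [NormedSpace ℝ E]
  {H : Type*} [TopologicalSpace H] {I : ModelWithCorners ℝ E H}
  {M : Type*} [TopologicalSpace M] [ChartedSpace H M] [IsManifold I ∞ M]

/-- `∇` is the Levi-Civita connection of the metric `g`: it is torsion free and
`X (g (Y, Z)) = g (∇_X Y, Z) + g (Y, ∇_X Z)`. Here `∇ Y x v` is `∇_v Y` at the point `x`. -/
structure IsLeviCivita [FiniteDimensional ℝ E]
    (g : ContMDiffRiemannianMetric I ∞ E (TangentSpace I : M → Type _))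
    (nabla : CovariantDerivative I E (TangentSpace I : M → Type _)) : Prop where
  torsion_eq_zero : nabla.torsion = 0
  metric : ∀ {x : M} {Y Z : Π x : M, TangentSpace I x}, MDiffAt (T% Y) x → MDiffAt (T% Z) x →
    ∀ v : TangentSpace I x, d% (fun y ↦ g.inner y (Y y) (Z y)) x v =
      g.inner x (nabla Y x v) (Z x) + g.inner x (Y x) (nabla Z x v)

lemma mdifferentiableAt_metric
    (g : ContMDiffRiemannianMetric I ∞ E (TangentSpace I : M → Type _))
    {x : M} {Y Z : Π x : M, TangentSpace I x} (hY : MDiffAt (T% Y) x) (hZ : MDiffAt (T% Z) x) :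
    MDiffAt (fun y ↦ g.inner y (Y y) (Z y)) x := by
  have h : MDifferentiableAt I (I.prod 𝓘(ℝ, ℝ))
      (fun m ↦ TotalSpace.mk' ℝ (E := Bundle.Trivial M ℝ) m (g.inner m (Y m) (Z m))) x :=
    MDifferentiableAt.clm_bundle_apply₂ (F₁ := E) (F₂ := E)
      ((g.contMDiff x).mdifferentiableAt (by simp)) hY hZ
  simp only [mdifferentiableAt_totalSpace] at h
  exact h.2

/-- The right-hand side of the Koszul formula (twice the Levi-Civita derivative paired with `Z`). -/
def koszul (g : ContMDiffRiemannianMetric I ∞ E (TangentSpace I : M → Type _))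
    (Y X Z : Π x : M, TangentSpace I x) (x : M) : ℝ :=
  d% (fun y ↦ g.inner y (Y y) (Z y)) x (X x) + d% (fun y ↦ g.inner y (X y) (Z y)) x (Y x)
    - d% (fun y ↦ g.inner y (X y) (Y y)) x (Z x)
    + g.inner x (mlieBracket I X Y x) (Z x) - g.inner x (mlieBracket I X Z x) (Y x)
    - g.inner x (mlieBracket I Y Z x) (X x)

variable (g : ContMDiffRiemannianMetric I ∞ E (TangentSpace I : M → Type _))

lemma d_smul_left {x : M} {f : M → ℝ} {Y Z : Π x : M, TangentSpace I x} (hf : MDiffAt f x)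
    (hY : MDiffAt (T% Y) x) (hZ : MDiffAt (T% Z) x) :
    d% (fun y ↦ g.inner y ((f • Y) y) (Z y)) x =
      f x • d% (fun y ↦ g.inner y (Y y) (Z y)) x + g.inner x (Y x) (Z x) • d% f x := by
  have := mvfderiv_mul hf (mdifferentiableAt_metric g hY hZ)
  rw [← this]
  congr 1
  ext y
  simp

lemma d_smul_right {x : M} {f : M → ℝ} {Y Z : Π x : M, TangentSpace I x} (hf : MDiffAt f x)
    (hY : MDiffAt (T% Y) x) (hZ : MDiffAt (T% Z) x) :
    d% (fun y ↦ g.inner y (Y y) ((f • Z) y)) x =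
      f x • d% (fun y ↦ g.inner y (Y y) (Z y)) x + g.inner x (Y x) (Z x) • d% f x := by
  have := mvfderiv_mul hf (mdifferentiableAt_metric g hY hZ)
  rw [← this]
  congr 1
  ext y
  simp

lemma d_add_left {x : M} {Y Y' Z : Π x : M, TangentSpace I x}
    (hY : MDiffAt (T% Y) x) (hY' : MDiffAt (T% Y') x) (hZ : MDiffAt (T% Z) x) :
    d% (fun y ↦ g.inner y ((Y + Y') y) (Z y)) x =
      d% (fun y ↦ g.inner y (Y y) (Z y)) x + d% (fun y ↦ g.inner y (Y' y) (Z y)) x := by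
  have := mvfderiv_add (mdifferentiableAt_metric g hY hZ) (mdifferentiableAt_metric g hY' hZ)
  rw [← this]
  congr 1
  ext y
  simp

lemma d_add_right {x : M} {Y Y' Z : Π x : M, TangentSpace I x}
    (hY : MDiffAt (T% Y) x) (hY' : MDiffAt (T% Y') x) (hZ : MDiffAt (T% Z) x) :
    d% (fun y ↦ g.inner y (Z y) ((Y + Y') y)) x =
      d% (fun y ↦ g.inner y (Z y) (Y y)) x + d% (fun y ↦ g.inner y (Z y) (Y' y)) x := by
  have := mvfderiv_add (mdifferentiableAt_metric g hZ hY) (mdifferentiableAt_metric g hZ hY')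
  rw [← this]
  congr 1
  ext y
  simp

variable [FiniteDimensional ℝ E]

lemma koszul_tensorial_left {x : M} {Y Z : Π x : M, TangentSpace I x}
    (hY : MDiffAt (T% Y) x) (hZ : MDiffAt (T% Z) x) :
    TensorialAt I E (fun X ↦ koszul g Y X Z x) x where
  smul {f X} hf hX := by
    simp only [koszul, d_smul_left g hf hX hZ, d_smul_left g hf hX hY,
      mlieBracket_smul_left hf hX]
    simp

    ring
  add {X X'} hX hX' := by
    simp only [koszul, d_add_left g hX hX' hZ, d_add_left g hX hX' hY,
      mlieBracket_add_left hX hX']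
    simp
    ring

lemma koszul_tensorial_right {x : M} {Y X : Π x : M, TangentSpace I x}
    (hY : MDiffAt (T% Y) x) (hX : MDiffAt (T% X) x) :
    TensorialAt I E (fun Z ↦ koszul g Y X Z x) x where
  smul {f Z} hf hZ := by
    simp only [koszul, d_smul_right g hf hX hZ, d_smul_right g hf hY hZ,
      mlieBracket_smul_right hf hZ]
    simp
    rw [g.symm x (Z x) (X x), g.symm x (Z x) (Y x)]
    ring
  add {Z Z'} hZ hZ' := by
    simp only [koszul, d_add_right g hZ hZ' hX, d_add_right g hZ hZ' hY,
      mlieBracket_add_right hZ hZ']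
    simp
    ring

lemma koszul_smul {x : M} {f : M → ℝ} {Y X Z : Π x : M, TangentSpace I x} (hf : MDiffAt f x)
    (hY : MDiffAt (T% Y) x) (hX : MDiffAt (T% X) x) (hZ : MDiffAt (T% Z) x) :
    koszul g (f • Y) X Z x = f x * koszul g Y X Z x
      + 2 * (d% f x (X x) * g.inner x (Y x) (Z x)) := by
  simp only [koszul, d_smul_left g hf hY hZ, d_smul_right g hf hX hY,
    mlieBracket_smul_left hf hY, mlieBracket_smul_right hf hY]
  simp
  rw [g.symm x (Y x) (X x)]
  ring

lemma koszul_add {x : M} {Y Y' X Z : Π x : M, TangentSpace I x}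
    (hY : MDiffAt (T% Y) x) (hY' : MDiffAt (T% Y') x) (hX : MDiffAt (T% X) x)
    (hZ : MDiffAt (T% Z) x) :
    koszul g (Y + Y') X Z x = koszul g Y X Z x + koszul g Y' X Z x := by
  simp only [koszul, d_add_left g hY hY' hZ, d_add_right g hY hY' hX,
    mlieBracket_add_left hY hY', mlieBracket_add_right hY hY']
  simp
  ring

/-- The isomorphism `T_x M ≃ T_x^* M` given by the metric. -/
def metricFlat (x : M) : TangentSpace I x ≃ₗ[ℝ] (TangentSpace I x →L[ℝ] ℝ) :=
  haveI : FiniteDimensional ℝ (TangentSpace I x) := inferInstanceAs (FiniteDimensional ℝ E)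
  haveI : T2Space (TangentSpace I x) := inferInstanceAs (T2Space E)
  haveI : FiniteDimensional ℝ (TangentSpace I x →L[ℝ] ℝ) :=
    (LinearMap.toContinuousLinearMap (𝕜 := ℝ) (E := TangentSpace I x) (F' := ℝ)).finiteDimensional
  LinearMap.linearEquivOfInjective (g.inner x : TangentSpace I x →ₗ[ℝ] (TangentSpace I x →L[ℝ] ℝ))
    ((injective_iff_map_eq_zero _).2 fun v hv ↦ by
      by_contra h
      have := g.pos x v h
      have h2 := DFunLike.congr_fun hv v
      simp at h2
      linarith)
    (by
      rw [← (LinearMap.toContinuousLinearMap (𝕜 := ℝ) (E := TangentSpace I x)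
        (F' := ℝ)).finrank_eq]
      exact Subspace.dual_finrank_eq.symm)

lemma inner_metricFlat_symm (x : M) (a : TangentSpace I x →L[ℝ] ℝ) (w : TangentSpace I x) :
    g.inner x ((metricFlat g x).symm a) w = a w :=
  DFunLike.congr_fun ((metricFlat g x).apply_symm_apply a) w

open Classical in
/-- The Levi-Civita derivative, obtained from the Koszul formula. -/
def leviCivitaFun (Y : Π x : M, TangentSpace I x) (x : M) :
    TangentSpace I x →L[ℝ] TangentSpace I x :=
  haveI : FiniteDimensional ℝ (TangentSpace I x) := inferInstanceAs (FiniteDimensional ℝ E)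
  haveI : T2Space (TangentSpace I x) := inferInstanceAs (T2Space E)
  if h : MDiffAt (T% Y) x then
    LinearMap.toContinuousLinearMap ((2⁻¹ : ℝ) • ((metricFlat g x).symm.toLinearMap ∘ₗ
      (TensorialAt.mkHom₂ (fun X Z ↦ koszul g Y X Z x) x
        (fun _ hZ ↦ koszul_tensorial_left g h hZ)
        (fun _ hX ↦ koszul_tensorial_right g h hX)).toLinearMap))
  else 0

/-- The Koszul formula. -/
lemma inner_leviCivitaFun {x : M} {Y X Z : Π x : M, TangentSpace I x}
    (hY : MDiffAt (T% Y) x) (hX : MDiffAt (T% X) x) (hZ : MDiffAt (T% Z) x) :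
    g.inner x (leviCivitaFun g Y x (X x)) (Z x) = 2⁻¹ * koszul g Y X Z x := by
  have := TensorialAt.mkHom₂_apply (Φ := fun X Z ↦ koszul g Y X Z x) (x := x)
    (fun _ hZ ↦ koszul_tensorial_left g hY hZ)
    (fun _ hX ↦ koszul_tensorial_right g hY hX) hX hZ
  simp only [leviCivitaFun, dif_pos hY]
  rw [← this]
  simp [inner_metricFlat_symm]

lemma eq_of_inner_eq {x : M} {v w : TangentSpace I x}
    (h : ∀ u, g.inner x v u = g.inner x w u) : v = w :=
  (metricFlat g x).injective (ContinuousLinearMap.ext h)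

/-- The Levi-Civita connection of a Riemannian metric; `leviCivita g Y x v` is `∇_v Y` at `x`
(for vector fields `Y` that are differentiable at `x`; the value is `0` for all others). -/
def leviCivita : CovariantDerivative I E (TangentSpace I : M → Type _) where
  toFun := leviCivitaFun g
  isCovariantDerivativeOnUniv :=
    { add := by
        intro Y Y' x hY hY' _
        ext v
        refine eq_of_inner_eq g fun u ↦ ?_
        obtain ⟨X, hX, rfl⟩ : ∃ X : Π x : M, TangentSpace I x, MDiffAt (T% X) x ∧ X x = v :=
          ⟨FiberBundle.extend E v, FiberBundle.mdifferentiableAt_extend .., by simp⟩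
        obtain ⟨Z, hZ, rfl⟩ : ∃ Z : Π x : M, TangentSpace I x, MDiffAt (T% Z) x ∧ Z x = u :=
          ⟨FiberBundle.extend E u, FiberBundle.mdifferentiableAt_extend .., by simp⟩
        have h := mdifferentiableAt_add_section hY hY'
        rw [inner_leviCivitaFun g h hX hZ, koszul_add g hY hY' hX hZ]
        simp [inner_leviCivitaFun g hY hX hZ, inner_leviCivitaFun g hY' hX hZ]
        ring
      leibniz := by
        intro Y f x hY hf _
        ext v
        refine eq_of_inner_eq g fun u ↦ ?_
        obtain ⟨X, hX, rfl⟩ : ∃ X : Π x : M, TangentSpace I x, MDiffAt (T% X) x ∧ X x = v :=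
          ⟨FiberBundle.extend E v, FiberBundle.mdifferentiableAt_extend .., by simp⟩
        obtain ⟨Z, hZ, rfl⟩ : ∃ Z : Π x : M, TangentSpace I x, MDiffAt (T% Z) x ∧ Z x = u :=
          ⟨FiberBundle.extend E u, FiberBundle.mdifferentiableAt_extend .., by simp⟩
        have h := hf.smul_section hY
        rw [inner_leviCivitaFun g h hX hZ, koszul_smul g hf hY hX hZ]
        simp [inner_leviCivitaFun g hY hX hZ]
        ring }

/-- The connection `leviCivita g` is torsion free and compatible with `g`. -/
theorem isLeviCivita_leviCivita : IsLeviCivita g (leviCivita g) where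
  torsion_eq_zero := by
    rw [CovariantDerivative.torsion_eq_zero_iff]
    intro X Y x hX hY
    refine eq_of_inner_eq g fun u ↦ ?_
    obtain ⟨Z, hZ, rfl⟩ : ∃ Z : Π x : M, TangentSpace I x, MDiffAt (T% Z) x ∧ Z x = u :=
      ⟨FiberBundle.extend E u, FiberBundle.mdifferentiableAt_extend .., by simp⟩
    simp only [map_sub, sub_apply]
    change g.inner x (leviCivitaFun g Y x (X x)) (Z x)
      - g.inner x (leviCivitaFun g X x (Y x)) (Z x) = _
    rw [inner_leviCivitaFun g hY hX hZ, inner_leviCivitaFun g hX hY hZ]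
    simp only [koszul]
    rw [mlieBracket_swap_apply (V := Y) (W := X)]
    have : (fun y ↦ g.inner y (X y) (Y y)) = fun y ↦ g.inner y (Y y) (X y) :=
      funext fun y ↦ g.symm y _ _
    rw [this]
    simp
    ring
  metric := by
    intro x Y Z hY hZ v
    obtain ⟨X, hX, rfl⟩ : ∃ X : Π x : M, TangentSpace I x, MDiffAt (T% X) x ∧ X x = v :=
      ⟨FiberBundle.extend E v, FiberBundle.mdifferentiableAt_extend .., by simp⟩
    rw [g.symm x (Y x)]
    change _ = g.inner x (leviCivitaFun g Y x (X x)) (Z x)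
      + g.inner x (leviCivitaFun g Z x (X x)) (Y x)
    rw [inner_leviCivitaFun g hY hX hZ, inner_leviCivitaFun g hZ hX hY]
    simp only [koszul]
    rw [mlieBracket_swap_apply (V := Z) (W := Y)]
    have : (fun y ↦ g.inner y (Z y) (Y y)) = fun y ↦ g.inner y (Y y) (Z y) :=
      funext fun y ↦ g.symm y _ _
    rw [this]
    simp
    ring

end LeviCivita

section SmoothHom

variable {EB : Type*} [NormedAddCommGroup EB] [NormedSpace ℝ EB]
  {HB : Type*} [TopologicalSpace HB] {IB : ModelWithCorners ℝ EB HB}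
  {B : Type*} [TopologicalSpace B] [ChartedSpace HB B]
  {F₁ : Type*} [NormedAddCommGroup F₁] [NormedSpace ℝ F₁] [FiniteDimensional ℝ F₁]
  {F₂ : Type*} [NormedAddCommGroup F₂] [NormedSpace ℝ F₂]
  {V₁ : B → Type*} [TopologicalSpace (TotalSpace F₁ V₁)]
  [∀ x, AddCommGroup (V₁ x)] [∀ x, Module ℝ (V₁ x)] [∀ x, TopologicalSpace (V₁ x)]
  [FiberBundle F₁ V₁] [VectorBundle ℝ F₁ V₁]
  {V₂ : B → Type*} [TopologicalSpace (TotalSpace F₂ V₂)]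
  [∀ x, AddCommGroup (V₂ x)] [∀ x, Module ℝ (V₂ x)] [∀ x, TopologicalSpace (V₂ x)]
  [∀ x, IsTopologicalAddGroup (V₂ x)] [∀ x, ContinuousSMul ℝ (V₂ x)]
  [FiberBundle F₂ V₂] [VectorBundle ℝ F₂ V₂]

/-- A family of linear maps between the fibres of two vector bundles is smooth at `x₀` if it sends
sections that are smooth at `x₀` to sections that are smooth at `x₀`. -/
lemma contMDiffAt_hom_of_apply [ContMDiffVectorBundle ∞ F₁ V₁ IB]
    (L : Π x : B, V₁ x →L[ℝ] V₂ x) (x₀ : B)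
    (h : ∀ s : Π x : B, V₁ x,
      ContMDiffAt IB (IB.prod 𝓘(ℝ, F₁)) ∞ (fun x ↦ TotalSpace.mk' F₁ x (s x)) x₀ →
      ContMDiffAt IB (IB.prod 𝓘(ℝ, F₂)) ∞ (fun x ↦ TotalSpace.mk' F₂ x (L x (s x))) x₀) :
    ContMDiffAt IB (IB.prod 𝓘(ℝ, F₁ →L[ℝ] F₂)) ∞
      (fun x ↦ TotalSpace.mk' (F₁ →L[ℝ] F₂) (E := fun x : B ↦ V₁ x →L[ℝ] V₂ x) x (L x)) x₀ := by
  rw [contMDiffAt_hom_bundle]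
  refine ⟨contMDiffAt_id, ?_⟩
  set c : B → F₁ →L[ℝ] F₂ :=
    fun x ↦ ContinuousLinearMap.inCoordinates F₁ V₁ F₂ V₂ x₀ x x₀ x (L x)
  change ContMDiffAt IB 𝓘(ℝ, F₁ →L[ℝ] F₂) ∞ c x₀
  let b := Module.finBasis ℝ F₁
  have hb (i) : ContMDiffAt IB 𝓘(ℝ, F₂) ∞ (fun x ↦ c x (b i)) x₀ := by
    have h1 := h _ (contMDiffAt_localFrame_of_mem (I := IB) (F := F₁) (V := V₁) ∞
      (trivializationAt F₁ V₁ x₀) b i (FiberBundle.mem_baseSet_trivializationAt F₁ V₁ x₀))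
    rw [contMDiffAt_section] at h1
    refine h1.congr_of_eventuallyEq ?_
    filter_upwards [(trivializationAt F₁ V₁ x₀).open_baseSet.mem_nhds
        (FiberBundle.mem_baseSet_trivializationAt F₁ V₁ x₀),
      (trivializationAt F₂ V₂ x₀).open_baseSet.mem_nhds
        (FiberBundle.mem_baseSet_trivializationAt F₂ V₂ x₀)] with x hx1 hx2
    simp only [c, ContinuousLinearMap.inCoordinates_eq hx1 hx2]
    simp [Bundle.Trivialization.localFrame_apply_of_mem_baseSet _ _ hx1,
      Bundle.Trivialization.basisAt]
  have hc : c = fun x ↦ ∑ i, ContinuousLinearMap.smulRightL ℝ F₁ F₂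
      (LinearMap.toContinuousLinearMap (b.coord i)) (c x (b i)) := by
    ext x v
    conv_lhs => rw [← b.sum_repr v, map_sum]
    simp
  rw [hc]
  refine ContMDiffAt.sum fun i _ ↦ ?_
  exact ((ContinuousLinearMap.contMDiff (n := ∞) _).contMDiffAt (x := c x₀ (b i))).comp x₀ (hb i)

end SmoothHom

section Structures

variable {E : Type*} [NormedAddCommGroup E] [NormedSpace ℝ E]
  {H : Type*} [TopologicalSpace H] (I : ModelWithCorners ℝ E H)
  (M : Type*) [TopologicalSpace M] [ChartedSpace H M] [IsManifold I ∞ M]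

/-- The smooth vector fields `𝔛(M)`. -/
abbrev SmoothVectorField := ContMDiffSection I E ∞ (TangentSpace I : M → Type _)

/-- The smooth `(1,1)`-tensor fields on `M`. -/
abbrev SmoothEndomorphismField := ContMDiffSection I (E →L[ℝ] E) ∞
  (fun x : M ↦ TangentSpace I x →L[ℝ] TangentSpace I x)

/-- The smooth `1`-forms on `M`. -/
abbrev SmoothOneForm := ContMDiffSection I (E →L[ℝ] ℝ) ∞
  (fun x : M ↦ TangentSpace I x →L[ℝ] Bundle.Trivial M ℝ x)

/-- An almost contact metric structure `(φ, ξ, η, g)` on `M`; all the tensor fields are smooth. -/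
structure AlmostContactMetricStructure where
  φ : SmoothEndomorphismField I M
  ξ : SmoothVectorField I M
  η : SmoothOneForm I M
  g : ContMDiffRiemannianMetric I ∞ E (TangentSpace I : M → Type _)
  φ_φ : ∀ (x : M) (v : TangentSpace I x), φ x (φ x v) = -v + (η x v : ℝ) • ξ x
  φ_ξ : ∀ x : M, φ x (ξ x) = 0
  η_φ : ∀ (x : M) (v : TangentSpace I x), η x (φ x v) = (0 : ℝ)
  η_ξ : ∀ x : M, η x (ξ x) = (1 : ℝ)
  g_φ_φ : ∀ (x : M) (v w : TangentSpace I x),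
    g.inner x (φ x v) (φ x w) = g.inner x v w - (η x v : ℝ) * (η x w : ℝ)
  η_eq : ∀ (x : M) (v : TangentSpace I x), (η x v : ℝ) = g.inner x (ξ x) v

/-- An almost Hermitian structure `(J, g)` on `M`. -/
structure AlmostHermitianStructure where
  J : SmoothEndomorphismField I M
  g : ContMDiffRiemannianMetric I ∞ E (TangentSpace I : M → Type _)
  J_J : ∀ (x : M) (v : TangentSpace I x), J x (J x v) = -v
  g_J_J : ∀ (x : M) (v w : TangentSpace I x), g.inner x (J x v) (J x w) = g.inner x v w

variable {I M}

/-- The covariant derivative `(∇_X A) Y = ∇_X (A Y) - A (∇_X Y)` of a field of endomorphisms. -/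
def CovariantDerivative.covEnd (nabla : CovariantDerivative I E (TangentSpace I : M → Type _))
    (A : Π x : M, TangentSpace I x →L[ℝ] TangentSpace I x) (X Y : Π x : M, TangentSpace I x)
    (x : M) : TangentSpace I x :=
  nabla (fun y ↦ A y (Y y)) x (X x) - A x (nabla Y x (X x))

/-- An almost Hermitian structure is quasi-Kähler if
`(∇_X J) Y + (∇_{J X} J) (J Y) = 0` for all smooth vector fields `X` and `Y`. -/
def AlmostHermitianStructure.IsQuasiKahler [FiniteDimensional ℝ E]
    (S : AlmostHermitianStructure I M) : Prop :=
  ∀ (X Y : SmoothVectorField I M) (x : M),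
    (leviCivita S.g).covEnd S.J X Y x
      + (leviCivita S.g).covEnd S.J (fun y ↦ S.J y (X y)) (fun y ↦ S.J y (Y y)) x = 0

end Structures

section Cone

variable {E : Type*} [NormedAddCommGroup E] [NormedSpace ℝ E]
  {H : Type*} [TopologicalSpace H] {I : ModelWithCorners ℝ E H}
  {M : Type*} [TopologicalSpace M] [ChartedSpace H M]

/-- The projection `T_{(x,t)} (M × ℝ) = T_x M × ℝ → T_x M`. -/
def tangentFst (p : M × ℝ) : TangentSpace (I.prod 𝓘(ℝ, ℝ)) p →L[ℝ] TangentSpace I p.1 :=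
  ContinuousLinearMap.fst ℝ E ℝ

/-- The projection `T_{(x,t)} (M × ℝ) = T_x M × ℝ → ℝ`. -/
def tangentSnd (p : M × ℝ) : TangentSpace (I.prod 𝓘(ℝ, ℝ)) p →L[ℝ] ℝ :=
  ContinuousLinearMap.snd ℝ E ℝ

/-- The inclusion `T_x M → T_x M × ℝ = T_{(x,t)} (M × ℝ)`. -/
def tangentInl (p : M × ℝ) : TangentSpace I p.1 →L[ℝ] TangentSpace (I.prod 𝓘(ℝ, ℝ)) p :=
  ContinuousLinearMap.inl ℝ E ℝ

/-- The vector field `∂/∂t` on `M × ℝ`. -/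
def ddt (p : M × ℝ) : TangentSpace (I.prod 𝓘(ℝ, ℝ)) p := ((0, 1) : E × ℝ)

@[simp] lemma tangentFst_inl (p : M × ℝ) (v : TangentSpace I p.1) :
    tangentFst p (tangentInl p v) = v := rfl

@[simp] lemma tangentSnd_inl (p : M × ℝ) (v : TangentSpace I p.1) :
    tangentSnd p (tangentInl p v) = 0 := rfl

@[simp] lemma tangentFst_ddt (p : M × ℝ) : tangentFst (I := I) p (ddt p) = 0 := rfl

@[simp] lemma tangentSnd_ddt (p : M × ℝ) : tangentSnd (I := I) p (ddt p) = 1 := rfl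

lemma tangentInl_add_smul_ddt (p : M × ℝ) (v : TangentSpace (I.prod 𝓘(ℝ, ℝ)) p) :
    tangentInl p (tangentFst p v) + tangentSnd p v • ddt p = v := by
  change ((v : E × ℝ).1, (0 : ℝ)) + (v : E × ℝ).2 • ((0, 1) : E × ℝ) = (v : E × ℝ)
  ext <;> simp

/-- `tangentFst` is the differential of the projection `M × ℝ → M`. -/
lemma tangentFst_eq_mfderiv (p : M × ℝ) :
    tangentFst (I := I) p = mfderiv (I.prod 𝓘(ℝ, ℝ)) I Prod.fst p := by
  rw [mfderiv_fst]
  rfl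

/-- `tangentSnd` is the differential of the projection `M × ℝ → ℝ`. -/
lemma tangentSnd_eq_mfderiv (p : M × ℝ) :
    tangentSnd (I := I) p = mfderiv (I.prod 𝓘(ℝ, ℝ)) 𝓘(ℝ, ℝ) Prod.snd p := by
  rw [mfderiv_snd]
  rfl

variable [IsManifold I ∞ M]

section smooth

variable {p₀ : M × ℝ} {s : Π p : M × ℝ, TangentSpace (I.prod 𝓘(ℝ, ℝ)) p}

lemma contMDiffAt_tangentFst
    (hs : ContMDiffAt (I.prod 𝓘(ℝ, ℝ)) ((I.prod 𝓘(ℝ, ℝ)).prod 𝓘(ℝ, E × ℝ)) ∞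
      (fun p ↦ TotalSpace.mk' (E × ℝ) p (s p)) p₀) :
    ContMDiffAt (I.prod 𝓘(ℝ, ℝ)) (I.prod 𝓘(ℝ, E)) ∞
      (fun p ↦ TotalSpace.mk' E (E := (TangentSpace I : M → Type _)) p.1 (tangentFst p (s p)))
      p₀ := by
  have h := (contMDiff_equivTangentBundleProd (n := ∞) (I := I) (M := M) (I' := 𝓘(ℝ, ℝ))
    (M' := ℝ)).contMDiffAt.comp p₀ hs
  exact h.fst

lemma contMDiffAt_tangentSnd
    (hs : ContMDiffAt (I.prod 𝓘(ℝ, ℝ)) ((I.prod 𝓘(ℝ, ℝ)).prod 𝓘(ℝ, E × ℝ)) ∞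
      (fun p ↦ TotalSpace.mk' (E × ℝ) p (s p)) p₀) :
    ContMDiffAt (I.prod 𝓘(ℝ, ℝ)) 𝓘(ℝ, ℝ) ∞ (fun p ↦ tangentSnd p (s p)) p₀ := by
  have h := (contMDiff_equivTangentBundleProd (n := ∞) (I := I) (M := M) (I' := 𝓘(ℝ, ℝ))
    (M' := ℝ)).contMDiffAt.comp p₀ hs
  exact (contMDiff_snd_tangentBundle_modelSpace ℝ 𝓘(ℝ, ℝ)).contMDiffAt.comp p₀ h.snd

lemma contMDiffAt_tangentInl {w : Π p : M × ℝ, TangentSpace I p.1}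
    (hw : ContMDiffAt (I.prod 𝓘(ℝ, ℝ)) (I.prod 𝓘(ℝ, E)) ∞
      (fun p ↦ TotalSpace.mk' E (E := (TangentSpace I : M → Type _)) p.1 (w p)) p₀) :
    ContMDiffAt (I.prod 𝓘(ℝ, ℝ)) ((I.prod 𝓘(ℝ, ℝ)).prod 𝓘(ℝ, E × ℝ)) ∞
      (fun p ↦ TotalSpace.mk' (E × ℝ) (E := (TangentSpace (I.prod 𝓘(ℝ, ℝ)) : M × ℝ → Type _)) p
        (tangentInl p (w p))) p₀ := by
  have h0 : ContMDiffAt (I.prod 𝓘(ℝ, ℝ)) (𝓘(ℝ, ℝ).prod 𝓘(ℝ, ℝ)) ∞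
      (fun p : M × ℝ ↦ TotalSpace.mk' ℝ (E := (TangentSpace 𝓘(ℝ, ℝ) : ℝ → Type _)) p.2 0) p₀ :=
    (contMDiff_zeroSection ℝ (TangentSpace 𝓘(ℝ, ℝ) : ℝ → Type _)).contMDiffAt.comp p₀
      contMDiffAt_snd
  exact (contMDiff_equivTangentBundleProd_symm (n := ∞) (I := I) (M := M) (I' := 𝓘(ℝ, ℝ))
    (M' := ℝ)).contMDiffAt.comp p₀ (hw.prodMk h0)

lemma contMDiffAt_ddt :
    ContMDiffAt (I.prod 𝓘(ℝ, ℝ)) ((I.prod 𝓘(ℝ, ℝ)).prod 𝓘(ℝ, E × ℝ)) ∞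
      (fun p ↦ TotalSpace.mk' (E × ℝ) (E := (TangentSpace (I.prod 𝓘(ℝ, ℝ)) : M × ℝ → Type _)) p
        (ddt p)) p₀ := by
  have h0 : ContMDiffAt (I.prod 𝓘(ℝ, ℝ)) (I.prod 𝓘(ℝ, E)) ∞
      (fun p : M × ℝ ↦ TotalSpace.mk' E (E := (TangentSpace I : M → Type _)) p.1 0) p₀ :=
    (contMDiff_zeroSection ℝ (TangentSpace I : M → Type _)).contMDiffAt.comp p₀
      contMDiffAt_fst
  have h1 : ContMDiffAt (I.prod 𝓘(ℝ, ℝ)) (𝓘(ℝ, ℝ).prod 𝓘(ℝ, ℝ)) ∞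
      (fun p : M × ℝ ↦ TotalSpace.mk' ℝ (E := (TangentSpace 𝓘(ℝ, ℝ) : ℝ → Type _)) p.2
        (1 : ℝ)) p₀ := by
    have : ContMDiff 𝓘(ℝ, ℝ) (𝓘(ℝ, ℝ).prod 𝓘(ℝ, ℝ)) ∞
        (fun t : ℝ ↦ TotalSpace.mk' ℝ (E := (TangentSpace 𝓘(ℝ, ℝ) : ℝ → Type _)) t (1 : ℝ)) :=
      contMDiff_vectorSpace_iff_contDiff.2 contDiff_const
    exact this.contMDiffAt.comp p₀ contMDiffAt_snd
  exact (contMDiff_equivTangentBundleProd_symm (n := ∞) (I := I) (M := M) (I' := 𝓘(ℝ, ℝ))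
    (M' := ℝ)).contMDiffAt.comp p₀ (h0.prodMk h1)

end smooth

namespace AlmostContactMetricStructure

variable (S : AlmostContactMetricStructure I M)

/-- `J̄ X = φ X - η(X) ∂/∂t` and `J̄ ∂/∂t = ξ`. -/
def coneJFun (p : M × ℝ) :
    TangentSpace (I.prod 𝓘(ℝ, ℝ)) p →L[ℝ] TangentSpace (I.prod 𝓘(ℝ, ℝ)) p :=
  tangentInl p ∘L S.φ p.1 ∘L tangentFst p + (tangentSnd p).smulRight (tangentInl p (S.ξ p.1))
    - ((S.η p.1 : TangentSpace I p.1 →L[ℝ] ℝ) ∘L tangentFst p).smulRight (ddt p)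

/-- `ḡ = e^{-2t} (g + dt²)`. -/
def coneInner (p : M × ℝ) :
    TangentSpace (I.prod 𝓘(ℝ, ℝ)) p →L[ℝ] TangentSpace (I.prod 𝓘(ℝ, ℝ)) p →L[ℝ] ℝ :=
  Real.exp (-2 * p.2) • ((tangentFst p).precomp ℝ ∘L S.g.inner p.1 ∘L tangentFst p
    + (tangentSnd p).smulRight (tangentSnd p))

lemma coneJFun_apply (p : M × ℝ) (v : TangentSpace (I.prod 𝓘(ℝ, ℝ)) p) :
    S.coneJFun p v = tangentInl p (S.φ p.1 (tangentFst p v))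
      + tangentSnd p v • tangentInl p (S.ξ p.1) - (S.η p.1 (tangentFst p v) : ℝ) • ddt p := rfl

lemma coneInner_apply (p : M × ℝ) (v w : TangentSpace (I.prod 𝓘(ℝ, ℝ)) p) :
    S.coneInner p v w = Real.exp (-2 * p.2) *
      (S.g.inner p.1 (tangentFst p v) (tangentFst p w) + tangentSnd p v * tangentSnd p w) := rfl

variable [FiniteDimensional ℝ E]

/-- The almost complex structure `J̄` on `M × ℝ`. -/
def coneJ : SmoothEndomorphismField (I.prod 𝓘(ℝ, ℝ)) (M × ℝ) where
  toFun := S.coneJFun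
  contMDiff_toFun p₀ := by
    refine contMDiffAt_hom_of_apply (F₁ := E × ℝ) (F₂ := E × ℝ) S.coneJFun p₀ fun s hs ↦ ?_
    have h1 := contMDiffAt_tangentFst hs
    have h2 := contMDiffAt_tangentSnd hs
    have hφ := contMDiffAt_tangentInl (ContMDiffAt.clm_bundle_apply (F₁ := E) (F₂ := E)
      (S.φ.contMDiff.contMDiffAt.comp p₀ contMDiffAt_fst) h1)
    have hξ := contMDiffAt_tangentInl (S.ξ.contMDiff.contMDiffAt.comp p₀ contMDiffAt_fst)
    have hη := ContMDiffAt.clm_bundle_apply (F₁ := E) (F₂ := ℝ)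
      (S.η.contMDiff.contMDiffAt.comp p₀ contMDiffAt_fst) h1
    rw [contMDiffAt_totalSpace] at hη
    exact (hφ.add_section (h2.smul_section hξ)).sub_section (hη.2.smul_section contMDiffAt_ddt)

/-- The Riemannian metric `ḡ` on `M × ℝ`. -/
def coneMetric : ContMDiffRiemannianMetric (I.prod 𝓘(ℝ, ℝ)) ∞ (E × ℝ)
    (TangentSpace (I.prod 𝓘(ℝ, ℝ)) : M × ℝ → Type _) where
  inner := S.coneInner
  symm p v w := by
    rw [coneInner_apply, coneInner_apply, S.g.symm, mul_comm (tangentSnd p v)]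
  pos p v hv := by
    rw [coneInner_apply]
    refine mul_pos (Real.exp_pos _) ?_
    by_cases h : tangentFst p v = 0
    · have h2 : tangentSnd p v ≠ 0 := fun h2 ↦ hv <| by
        rw [← tangentInl_add_smul_ddt p v, h, h2]
        simp
      simp [h, h2]
    · exact add_pos_of_pos_of_nonneg (S.g.pos _ _ h) (mul_self_nonneg _)
  isVonNBounded p := by
    have hg := S.g.isVonNBounded p.1
    obtain ⟨C, hC⟩ : ∃ C, ∀ v : E, S.g.inner p.1 v v < 1 → ‖v‖ ≤ C :=
      isBounded_iff_forall_norm_le.1 ((NormedSpace.isVonNBounded_iff ℝ (E := E)).1 hg)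
    refine (NormedSpace.isVonNBounded_iff ℝ (E := E × ℝ)).2
      (isBounded_iff_forall_norm_le.2 ⟨max (Real.exp p.2 * C) (Real.exp p.2), ?_⟩)
    intro v hv
    have hv' : Real.exp (-2 * p.2) * (S.g.inner p.1 v.1 v.1 + v.2 * v.2) < 1 := hv
    have hpos : 0 ≤ S.g.inner p.1 v.1 v.1 := by
      by_cases h : v.1 = 0
      · rw [h]
        exact (map_zero (S.g.inner p.1 0)).ge
      · exact (S.g.pos p.1 v.1 h).le
    have hexp : Real.exp (-2 * p.2) = Real.exp (-p.2) * Real.exp (-p.2) := by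
      rw [← Real.exp_add]
      ring_nf
    have hcancel : Real.exp p.2 * Real.exp (-p.2) = 1 := by
      rw [← Real.exp_add]
      simp
    have hsm (c : ℝ) (u : TangentSpace I p.1) :
        S.g.inner p.1 (c • u) (c • u) = c * (c * S.g.inner p.1 u u) := by simp
    have hE := Real.exp_pos (-p.2)
    have hE' := Real.exp_pos p.2
    refine max_le_max ?_ ?_
    · have h1 : S.g.inner p.1 (Real.exp (-p.2) • v.1) (Real.exp (-p.2) • v.1) < 1 := by
        refine lt_of_eq_of_lt (hsm (Real.exp (-p.2)) v.1) ?_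
        nlinarith [mul_nonneg (mul_pos hE hE).le (mul_self_nonneg v.2)]
      have h2 := hC _ h1
      rw [norm_smul, Real.norm_of_nonneg hE.le] at h2
      calc ‖v.1‖ = Real.exp p.2 * (Real.exp (-p.2) * ‖v.1‖) := by
            rw [← mul_assoc, hcancel, one_mul]
        _ ≤ _ := by gcongr
    · have h1 : (Real.exp (-p.2) * v.2) ^ 2 < 1 := by
        nlinarith [mul_nonneg (mul_pos hE hE).le hpos]
      have h2 : |Real.exp (-p.2) * v.2| < 1 := (sq_lt_one_iff_abs_lt_one _).1 h1
      rw [abs_mul, abs_of_pos hE] at h2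
      rw [Real.norm_eq_abs]
      calc |v.2| = Real.exp p.2 * (Real.exp (-p.2) * |v.2|) := by
            rw [← mul_assoc, hcancel, one_mul]
        _ ≤ Real.exp p.2 * 1 := by gcongr
        _ = _ := mul_one _
  contMDiff p₀ := by
    refine contMDiffAt_hom_of_apply (F₁ := E × ℝ) (F₂ := (E × ℝ) →L[ℝ] ℝ)
      (V₂ := fun p : M × ℝ ↦ TangentSpace (I.prod 𝓘(ℝ, ℝ)) p →L[ℝ] Bundle.Trivial (M × ℝ) ℝ p)
      S.coneInner p₀ fun s hs ↦ ?_
    refine contMDiffAt_hom_of_apply (F₁ := E × ℝ) (F₂ := ℝ) (V₂ := Bundle.Trivial (M × ℝ) ℝ)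
      (fun p ↦ S.coneInner p (s p)) p₀ fun s' hs' ↦ ?_
    have h1 := contMDiffAt_tangentFst hs
    have h2 := contMDiffAt_tangentSnd hs
    have h1' := contMDiffAt_tangentFst hs'
    have h2' := contMDiffAt_tangentSnd hs'
    have hg := ContMDiffAt.clm_bundle_apply₂ (F₁ := E) (F₂ := E) (F₃ := ℝ) (E₃ := Bundle.Trivial M ℝ)
      (S.g.contMDiff.contMDiffAt.comp p₀ contMDiffAt_fst) h1 h1'
    rw [contMDiffAt_totalSpace] at hg ⊢
    refine ⟨contMDiffAt_id, ?_⟩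
    have he : ContMDiffAt (I.prod 𝓘(ℝ, ℝ)) 𝓘(ℝ, ℝ) ∞ (fun p : M × ℝ ↦ Real.exp (-2 * p.2)) p₀ :=
      (Real.contDiff_exp.comp (contDiff_const.mul contDiff_id)).contMDiff.contMDiffAt.comp p₀
        contMDiffAt_snd
    exact he.mul (hg.2.add (h2.mul h2'))

/-- The almost Hermitian structure `(J̄, ḡ)` on `M × ℝ`. -/
def cone : AlmostHermitianStructure (I.prod 𝓘(ℝ, ℝ)) (M × ℝ) where
  J := S.coneJ
  g := S.coneMetric
  J_J p v := by
    change S.coneJFun p (S.coneJFun p v) = -v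
    have h1 : tangentFst p (S.coneJFun p v)
        = S.φ p.1 (tangentFst p v) + tangentSnd p v • S.ξ p.1 := by
      simp [coneJFun_apply]
    have h2 : tangentSnd p (S.coneJFun p v) = -(S.η p.1 (tangentFst p v) : ℝ) := by
      simp [coneJFun_apply]
    rw [coneJFun_apply S p (S.coneJFun p v), h1, h2]
    conv_rhs => rw [← tangentInl_add_smul_ddt p v]
    have h3 : S.η p.1 (S.φ p.1 (tangentFst p v) + tangentSnd p v • S.ξ p.1)
        = tangentSnd p v := by
      rw [map_add, map_smul, S.η_φ, S.η_ξ]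
      simp
    rw [h3, map_add, map_smul, S.φ_φ, S.φ_ξ]
    simp only [map_add, map_neg, map_smul, smul_zero, add_zero]
    module
  g_J_J p v w := by
    change S.coneInner p (S.coneJFun p v) (S.coneJFun p w) = S.coneInner p v w
    have h1 (v) : tangentFst p (S.coneJFun p v)
        = S.φ p.1 (tangentFst p v) + tangentSnd p v • S.ξ p.1 := by
      simp [coneJFun_apply]
    have h2 (v) : tangentSnd p (S.coneJFun p v) = -(S.η p.1 (tangentFst p v) : ℝ) := by
      simp [coneJFun_apply]
    have h3 (u) : S.g.inner p.1 (S.ξ p.1) (S.φ p.1 u) = 0 := by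
      rw [← S.η_eq]
      exact S.η_φ p.1 u
    have h4 : S.g.inner p.1 (S.ξ p.1) (S.ξ p.1) = 1 := by
      rw [← S.η_eq]
      exact S.η_ξ p.1
    rw [coneInner_apply, coneInner_apply, h1, h1, h2, h2]
    simp only [map_add, map_smul, add_apply, smul_apply, smul_eq_mul, h3, h4,
      S.g.symm p.1 _ (S.ξ p.1), S.g_φ_φ]
    ring

/-- `(M, φ, ξ, η, g)` is a quasi contact metric manifold if `(M × ℝ, J̄, ḡ)` is quasi-Kähler. -/
def IsQuasiContactMetric : Prop := S.cone.IsQuasiKahler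

/-- The tensor field `h = ½ L_ξ φ`, where `(L_ξ φ) X = [ξ, φ X] - φ [ξ, X]`. -/
def h (X : Π x : M, TangentSpace I x) (x : M) : TangentSpace I x :=
  (2⁻¹ : ℝ) • (mlieBracket I S.ξ (fun y ↦ S.φ y (X y)) x - S.φ x (mlieBracket I S.ξ X x))

/-- Condition `(C₁)`: `(∇_X φ) Y + (∇_{φ X} φ) (φ Y) =
2 g(X, Y) ξ - η(Y) X - η(X) η(Y) ξ - η(Y) h X` for all smooth vector fields `X` and `Y`. -/
def ConditionC₁ : Prop :=
  ∀ (X Y : SmoothVectorField I M) (x : M),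
    (leviCivita S.g).covEnd S.φ X Y x
        + (leviCivita S.g).covEnd S.φ (fun y ↦ S.φ y (X y)) (fun y ↦ S.φ y (Y y)) x =
      (2 * S.g.inner x (X x) (Y x)) • S.ξ x - (S.η x (Y x) : ℝ) • X x
        - ((S.η x (X x) : ℝ) * (S.η x (Y x) : ℝ)) • S.ξ x - (S.η x (Y x) : ℝ) • S.h X x

end AlmostContactMetricStructure

end Cone

end

noncomputable section

section ProductBracket

variable {E : Type*} [NormedAddCommGroup E] [NormedSpace ℝ E]
  {H : Type*} [TopologicalSpace H] {I : ModelWithCorners ℝ E H}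
  {M : Type*} [TopologicalSpace M] [ChartedSpace H M]

/-- The vector field `X + a ∂/∂t` on `M × ℝ`, where `a` is a constant. -/
def coneLift (X : Π x : M, TangentSpace I x) (a : ℝ) (p : M × ℝ) :
    TangentSpace (I.prod 𝓘(ℝ, ℝ)) p :=
  tangentInl p (X p.1) + a • ddt p

lemma coneLift_eq (X : Π x : M, TangentSpace I x) (a : ℝ) (p : M × ℝ) :
    coneLift X a p = ((X p.1, a) : E × ℝ) := by
  have (v : E) : ((v, 0) : E × ℝ) + a • ((0, 1) : E × ℝ) = (v, a) := by simp
  exact this (X p.1)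

@[simp] lemma tangentFst_coneLift (X : Π x : M, TangentSpace I x) (a : ℝ) (p : M × ℝ) :
    tangentFst p (coneLift X a p) = X p.1 := by
  simp [coneLift]

@[simp] lemma tangentSnd_coneLift (X : Π x : M, TangentSpace I x) (a : ℝ) (p : M × ℝ) :
    tangentSnd p (coneLift X a p) = a := by
  simp [coneLift]

variable [IsManifold I ∞ M]

lemma isInvertible_prodMap_id {F G : Type*} [NormedAddCommGroup F] [NormedSpace ℝ F]
    [NormedAddCommGroup G] [NormedSpace ℝ G] {A : F →L[ℝ] G} (hA : A.IsInvertible) :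
    (A.prodMap (ContinuousLinearMap.id ℝ ℝ)).IsInvertible := by
  obtain ⟨e, rfl⟩ := hA
  exact ⟨e.prodCongr (.refl ℝ ℝ), rfl⟩

lemma inverse_prodMap_id_apply {F G : Type*} [NormedAddCommGroup F] [NormedSpace ℝ F]
    [NormedAddCommGroup G] [NormedSpace ℝ G] {A : F →L[ℝ] G} (hA : A.IsInvertible) (v : G) (a : ℝ) :
    (A.prodMap (ContinuousLinearMap.id ℝ ℝ)).inverse (v, a) = (A.inverse v, a) := by
  rw [(isInvertible_prodMap_id hA).inverse_apply_eq]
  simp [hA.self_apply_inverse]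

lemma mfderivWithin_extChartAt_symm_prod (p : M × ℝ) {y : E × ℝ}
    (hy : y.1 ∈ (extChartAt I p.1).target) :
    (mfderivWithin 𝓘(ℝ, E × ℝ) (I.prod 𝓘(ℝ, ℝ)) (extChartAt (I.prod 𝓘(ℝ, ℝ)) p).symm
      (Set.range (I.prod 𝓘(ℝ, ℝ))) y : E × ℝ →L[ℝ] E × ℝ) =
    ContinuousLinearMap.prodMap
      (mfderivWithin 𝓘(ℝ, E) I (extChartAt I p.1).symm (Set.range I) y.1 : E →L[ℝ] E)
      (ContinuousLinearMap.id ℝ ℝ) := by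
  have h1 : ⇑(extChartAt (I.prod 𝓘(ℝ, ℝ)) p).symm = Prod.map (extChartAt I p.1).symm id := by
    rw [extChartAt_prod]
    rfl
  have h2 : Set.range (I.prod 𝓘(ℝ, ℝ)) = Set.range I ×ˢ Set.univ := by
    rw [modelWithCorners_prod_coe, Set.range_prodMap]
    simp
  rw [h1, h2]
  have := mfderivWithin_prodMap (I := 𝓘(ℝ, E)) (J := I) (I' := 𝓘(ℝ, ℝ)) (J' := 𝓘(ℝ, ℝ)) (p := y)
    (s := Set.range I) (t := Set.univ) (g := (id : ℝ → ℝ))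
    (mdifferentiableWithinAt_extChartAt_symm hy)
    mdifferentiableWithinAt_id (I.uniqueMDiffOn _ (extChartAt_target_subset_range _ hy))
    (uniqueMDiffWithinAt_univ _)
  rw [mfderivWithin_id (uniqueMDiffWithinAt_univ _)] at this
  rw [modelWithCornersSelf_prod, ← chartedSpaceSelf_prod]
  exact this

lemma mfderiv_extChartAt_prod (p : M × ℝ) :
    (mfderiv (I.prod 𝓘(ℝ, ℝ)) 𝓘(ℝ, E × ℝ) (extChartAt (I.prod 𝓘(ℝ, ℝ)) p) p
      : E × ℝ →L[ℝ] E × ℝ) =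
    ContinuousLinearMap.prodMap
      (mfderiv I 𝓘(ℝ, E) (extChartAt I p.1) p.1 : E →L[ℝ] E)
      (ContinuousLinearMap.id ℝ ℝ) := by
  have h1 : ⇑(extChartAt (I.prod 𝓘(ℝ, ℝ)) p) = Prod.map (extChartAt I p.1) id := by
    rw [extChartAt_prod]
    rfl
  rw [h1]
  have := mfderiv_prodMap (I := I) (J := 𝓘(ℝ, E)) (I' := 𝓘(ℝ, ℝ)) (J' := 𝓘(ℝ, ℝ)) (p := p)
    (g := (id : ℝ → ℝ)) (f := extChartAt I p.1)
    (mdifferentiableAt_extChartAt (ChartedSpace.mem_chart_source _))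
    mdifferentiableAt_id
  rw [mfderiv_id] at this
  rw [modelWithCornersSelf_prod, ← chartedSpaceSelf_prod]
  exact this

lemma mpullbackWithin_coneLift (X : Π x : M, TangentSpace I x) (a : ℝ) (p : M × ℝ) {y : E × ℝ}
    (hy : y.1 ∈ (extChartAt I p.1).target) :
    mpullbackWithin 𝓘(ℝ, E × ℝ) (I.prod 𝓘(ℝ, ℝ)) (extChartAt (I.prod 𝓘(ℝ, ℝ)) p).symm
      (coneLift X a) (Set.range (I.prod 𝓘(ℝ, ℝ))) y =
    ((mpullbackWithin 𝓘(ℝ, E) I (extChartAt I p.1).symm X (Set.range I) y.1 : E), a) := by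
  obtain ⟨A, hA⟩ : ∃ A : E →L[ℝ] E,
    A = mfderivWithin 𝓘(ℝ, E) I (extChartAt I p.1).symm (Set.range I) y.1 := ⟨_, rfl⟩
  have hinv : A.IsInvertible := hA ▸ isInvertible_mfderivWithin_extChartAt_symm hy
  have h := mfderivWithin_extChartAt_symm_prod p hy
  rw [mpullbackWithin_apply, mpullbackWithin_apply]
  refine Eq.trans (congrArg (fun B : E × ℝ →L[ℝ] E × ℝ ↦ B.inverse _)
    (h.trans (congrArg (fun B : E →L[ℝ] E ↦ B.prodMap (.id ℝ ℝ)) hA.symm))) ?_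
  refine Eq.trans ?_ (congrArg (fun B : E →L[ℝ] E ↦ ((B.inverse
    (X ((extChartAt I p.1).symm y.1)) : E), a)) hA)
  refine Eq.trans ?_ (inverse_prodMap_id_apply hinv _ _)
  refine congrArg _ (Eq.trans (coneLift_eq X a _) ?_)
  rfl

lemma lieBracketWithin_prod_const {V W : E → E} {s : Set E} {x : E × ℝ} (a b : ℝ)
    (hV : DifferentiableWithinAt ℝ V s x.1) (hW : DifferentiableWithinAt ℝ W s x.1)
    (hs : UniqueDiffWithinAt ℝ s x.1) :
    lieBracketWithin ℝ (fun y : E × ℝ ↦ (V y.1, a)) (fun y ↦ (W y.1, b)) (s ×ˢ Set.univ) x =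
      (lieBracketWithin ℝ V W s x.1, 0) := by
  have hu : UniqueDiffWithinAt ℝ (s ×ˢ (Set.univ : Set ℝ)) x := hs.prod uniqueDiffWithinAt_univ
  have key {U : E → E} (c : ℝ) (hU : DifferentiableWithinAt ℝ U s x.1) (v : E × ℝ) :
      fderivWithin ℝ (fun y : E × ℝ ↦ (U y.1, c)) (s ×ˢ Set.univ) x v
        = (fderivWithin ℝ U s x.1 v.1, 0) := by
    have h1 : HasFDerivWithinAt (fun y : E × ℝ ↦ U y.1)
        ((fderivWithin ℝ U s x.1).comp (ContinuousLinearMap.fst ℝ E ℝ)) (s ×ˢ Set.univ) x :=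
      hU.hasFDerivWithinAt.comp x hasFDerivWithinAt_fst (fun y hy ↦ hy.1)
    rw [(h1.prodMk (hasFDerivWithinAt_const c x _)).fderivWithin hu]
    rfl
  simp only [lieBracketWithin, key _ hV, key _ hW]
  simp

variable [FiniteDimensional ℝ E]

lemma mlieBracket_coneLift {X Y : Π x : M, TangentSpace I x} (a b : ℝ) (p : M × ℝ)
    (hX : MDiffAt (T% X) p.1) (hY : MDiffAt (T% Y) p.1) :
    mlieBracket (I.prod 𝓘(ℝ, ℝ)) (coneLift X a) (coneLift Y b) p =
      tangentInl p (mlieBracket I X Y p.1) := by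
  have h2 : Set.range (I.prod 𝓘(ℝ, ℝ)) = Set.range I ×ˢ Set.univ := by
    rw [modelWithCorners_prod_coe, Set.range_prodMap]
    simp
  have h3 : extChartAt (I.prod 𝓘(ℝ, ℝ)) p p = (extChartAt I p.1 p.1, p.2) := by
    rw [extChartAt_prod]
    rfl
  rw [← mlieBracketWithin_univ, ← mlieBracketWithin_univ, mlieBracketWithin_apply,
    mlieBracketWithin_apply]
  simp only [Set.preimage_univ, Set.univ_inter]
  have htop : (extChartAt I p.1).target ×ˢ Set.univ ∈
      𝓝[Set.range (I.prod 𝓘(ℝ, ℝ))] (extChartAt (I.prod 𝓘(ℝ, ℝ)) p p) := by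
    rw [h2, h3, nhdsWithin_prod_eq]
    exact Filter.prod_mem_prod (extChartAt_target_mem_nhdsWithin p.1) Filter.univ_mem
  have hmem : extChartAt (I.prod 𝓘(ℝ, ℝ)) p p ∈ Set.range (I.prod 𝓘(ℝ, ℝ)) := by
    rw [h2, h3]
    exact ⟨extChartAt_target_subset_range _ (mem_extChartAt_target p.1), trivial⟩
  have key (Z : Π x : M, TangentSpace I x) (c : ℝ) :
      (mpullbackWithin 𝓘(ℝ, E × ℝ) (I.prod 𝓘(ℝ, ℝ)) (extChartAt (I.prod 𝓘(ℝ, ℝ)) p).symm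
        (coneLift Z c) (Set.range (I.prod 𝓘(ℝ, ℝ))) : E × ℝ → E × ℝ) =ᶠ[
        𝓝[Set.range (I.prod 𝓘(ℝ, ℝ))] (extChartAt (I.prod 𝓘(ℝ, ℝ)) p p)]
      fun y ↦ ((mpullbackWithin 𝓘(ℝ, E) I (extChartAt I p.1).symm Z (Set.range I) y.1 : E), c) := by
    filter_upwards [htop] with y hy
    exact mpullbackWithin_coneLift Z c p hy.1
  have hd {Z : Π x : M, TangentSpace I x} (hZ : MDiffAt (T% Z) p.1) :
      DifferentiableWithinAt ℝ (mpullbackWithin 𝓘(ℝ, E) I (extChartAt I p.1).symm Z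
        (Set.range I) : E → E) (Set.range I) (extChartAt I p.1 p.1) := by
    have := hZ.mdifferentiableWithinAt (s := Set.univ)
      |>.differentiableWithinAt_mpullbackWithin_vectorField
    simpa using this
  have hs : UniqueDiffWithinAt ℝ (Set.range I) (extChartAt I p.1 p.1) :=
    I.uniqueDiffOn _ (extChartAt_target_subset_range _ (mem_extChartAt_target p.1))
  have h4 := Filter.EventuallyEq.lieBracketWithin_vectorField_eq (𝕜 := ℝ) (E := E × ℝ) (key X a)
    ((key X a).self_of_nhdsWithin hmem) (key Y b) ((key Y b).self_of_nhdsWithin hmem)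
  have h5 := lieBracketWithin_prod_const (x := (extChartAt I p.1 p.1, p.2)) a b (hd hX) (hd hY) hs
  rw [← h2, ← h3] at h5
  obtain ⟨A, hA⟩ : ∃ A : E →L[ℝ] E, A = mfderiv I 𝓘(ℝ, E) (extChartAt I p.1) p.1 := ⟨_, rfl⟩
  have hinv : A.IsInvertible := hA ▸ isInvertible_mfderiv_extChartAt (mem_extChartAt_source p.1)
  have h6 := (mfderiv_extChartAt_prod p).trans
    (congrArg (fun B : E →L[ℝ] E ↦ B.prodMap (.id ℝ ℝ)) hA.symm)
  refine Eq.trans (congrArg (fun B : E × ℝ →L[ℝ] E × ℝ ↦ B.inverse _) h6) ?_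
  refine Eq.trans (congrArg (A.prodMap (.id ℝ ℝ)).inverse (h4.trans h5)) ?_
  refine (inverse_prodMap_id_apply hinv _ _).trans ?_
  rw [hA, h3]
  rfl

end ProductBracket

section ConeConnection

variable {E : Type*} [NormedAddCommGroup E] [NormedSpace ℝ E]
  {H : Type*} [TopologicalSpace H] {I : ModelWithCorners ℝ E H}
  {M : Type*} [TopologicalSpace M] [ChartedSpace H M]

lemma mvfderiv_comp_fst {f : M → ℝ} {p : M × ℝ} (hf : MDiffAt f p.1)
    (v : TangentSpace (I.prod 𝓘(ℝ, ℝ)) p) :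
    d% (fun q : M × ℝ ↦ f q.1) p v = d% f p.1 (tangentFst p v) := by
  rw [tangentFst_eq_mfderiv]
  exact mvfderiv_comp_apply p hf mdifferentiableAt_fst v

lemma mvfderiv_exp_neg_two_mul_snd (p : M × ℝ) (v : TangentSpace (I.prod 𝓘(ℝ, ℝ)) p) :
    d% (fun q : M × ℝ ↦ Real.exp (-2 * q.2)) p v = -2 * Real.exp (-2 * p.2) * tangentSnd p v := by
  have h : HasDerivAt (fun t : ℝ ↦ Real.exp (-2 * t)) (Real.exp (-2 * p.2) * -2) p.2 := by
    simpa using ((hasDerivAt_id p.2).const_mul (-2)).exp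
  have h1 := mvfderiv_comp_apply (I := 𝓘(ℝ, ℝ)) (I' := I.prod 𝓘(ℝ, ℝ)) p
    (g := fun t : ℝ ↦ Real.exp (-2 * t)) (f := Prod.snd)
    h.differentiableAt.mdifferentiableAt mdifferentiableAt_snd v
  refine h1.trans ?_
  rw [← tangentSnd_eq_mfderiv]
  have h2 (s : ℝ) : (fderiv ℝ (fun t : ℝ ↦ Real.exp (-2 * t)) p.2) s
      = -2 * Real.exp (-2 * p.2) * s := by
    rw [h.hasFDerivAt.fderiv, ContinuousLinearMap.toSpanSingleton_apply, smul_eq_mul]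
    ring
  refine Eq.trans ?_ (h2 _)
  rw [← mfderiv_eq_fderiv]
  rfl

lemma mdifferentiableAt_exp_neg_two_mul_snd (p : M × ℝ) :
    MDifferentiableAt (I.prod 𝓘(ℝ, ℝ)) 𝓘(ℝ, ℝ) (fun q : M × ℝ ↦ Real.exp (-2 * q.2)) p := by
  have h : DifferentiableAt ℝ (fun t : ℝ ↦ Real.exp (-2 * t)) p.2 := by fun_prop
  exact h.mdifferentiableAt.comp p mdifferentiableAt_snd

variable [IsManifold I ∞ M]

lemma contMDiffAt_coneLift {X : Π x : M, TangentSpace I x} (a : ℝ) {p : M × ℝ}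
    (hX : ContMDiffAt I (I.prod 𝓘(ℝ, E)) ∞ (T% X) p.1) :
    ContMDiffAt (I.prod 𝓘(ℝ, ℝ)) ((I.prod 𝓘(ℝ, ℝ)).prod 𝓘(ℝ, E × ℝ)) ∞
      (fun p ↦ TotalSpace.mk' (E × ℝ) (E := (TangentSpace (I.prod 𝓘(ℝ, ℝ)) : M × ℝ → Type _)) p
        (coneLift X a p)) p :=
  (contMDiffAt_tangentInl (ContMDiffAt.comp p hX contMDiffAt_fst)).add_section
    (contMDiffAt_const.smul_section contMDiffAt_ddt)

variable (S : AlmostContactMetricStructure I M)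

namespace AlmostContactMetricStructure

lemma coneInner_coneLift (X Y : Π x : M, TangentSpace I x) (a b : ℝ) (p : M × ℝ) :
    S.coneInner p (coneLift X a p) (coneLift Y b p) =
      Real.exp (-2 * p.2) * (S.g.inner p.1 (X p.1) (Y p.1) + a * b) := by
  simp [coneInner_apply]

lemma mvfderiv_coneInner_coneLift {X Y : Π x : M, TangentSpace I x} (a b : ℝ) {p : M × ℝ}
    (hX : MDiffAt (T% X) p.1) (hY : MDiffAt (T% Y) p.1) (v : TangentSpace (I.prod 𝓘(ℝ, ℝ)) p) :
    d% (fun q ↦ S.coneInner q (coneLift X a q) (coneLift Y b q)) p v =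
      Real.exp (-2 * p.2) * (d% (fun y ↦ S.g.inner y (X y) (Y y)) p.1 (tangentFst p v)
        - 2 * tangentSnd p v * (S.g.inner p.1 (X p.1) (Y p.1) + a * b)) := by
  have h1 := mdifferentiableAt_metric S.g hX hY
  have h2 : MDiffAt (fun q : M × ℝ ↦ S.g.inner q.1 (X q.1) (Y q.1)) p :=
    h1.comp p mdifferentiableAt_fst
  have h3 : MDiffAt (fun _ : M × ℝ ↦ a * b) p := mdifferentiableAt_const
  have h4 := mvfderiv_mul (mdifferentiableAt_exp_neg_two_mul_snd (I := I) p) (h2.add h3)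
  have h5 := mvfderiv_add h2 h3
  have h6 : (fun q ↦ S.coneInner q (coneLift X a q) (coneLift Y b q)) =
      (fun q : M × ℝ ↦ Real.exp (-2 * q.2)) *
        ((fun q : M × ℝ ↦ S.g.inner q.1 (X q.1) (Y q.1)) + fun _ ↦ a * b) := by
    ext q
    exact S.coneInner_coneLift X Y a b q
  rw [h6, h4, h5, mvfderiv_const]
  have h7 := mvfderiv_exp_neg_two_mul_snd p v
  have h8 := mvfderiv_comp_fst h1 v
  simp only [add_apply, smul_apply, h7, h8]
  simp
  ring

variable [FiniteDimensional ℝ E]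

lemma koszul_coneMetric_coneLift {X Y Z : Π x : M, TangentSpace I x} (a b c : ℝ) {p : M × ℝ}
    (hX : MDiffAt (T% X) p.1) (hY : MDiffAt (T% Y) p.1) (hZ : MDiffAt (T% Z) p.1) :
    koszul S.coneMetric (coneLift Y b) (coneLift X a) (coneLift Z c) p =
      Real.exp (-2 * p.2) * (koszul S.g Y X Z p.1
        - 2 * a * (S.g.inner p.1 (Y p.1) (Z p.1) + b * c)
        - 2 * b * (S.g.inner p.1 (X p.1) (Z p.1) + a * c)
        + 2 * c * (S.g.inner p.1 (X p.1) (Y p.1) + a * b)) := by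
  have h (U V : Π x : M, TangentSpace I x) (c : ℝ) :
      S.coneInner p (tangentInl p (U p.1)) (coneLift V c p) =
        Real.exp (-2 * p.2) * S.g.inner p.1 (U p.1) (V p.1) := by
    simp [coneInner_apply]
  have e : S.coneMetric.inner = S.coneInner := rfl
  simp only [koszul, e, mlieBracket_coneLift _ _ p hX hY, mlieBracket_coneLift _ _ p hX hZ,
    mlieBracket_coneLift _ _ p hY hZ, S.mvfderiv_coneInner_coneLift _ _ hX hY,
    S.mvfderiv_coneInner_coneLift _ _ hX hZ, S.mvfderiv_coneInner_coneLift _ _ hY hZ, h,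
    tangentFst_coneLift, tangentSnd_coneLift]
  ring

/-- The Levi-Civita connection of `ḡ` on the vector fields `Y + b ∂/∂t`. -/
lemma leviCivita_coneMetric_coneLift {Y : Π x : M, TangentSpace I x} (b : ℝ) {p : M × ℝ}
    (hY : ContMDiffAt I (I.prod 𝓘(ℝ, E)) ∞ (T% Y) p.1) (v : TangentSpace (I.prod 𝓘(ℝ, ℝ)) p) :
    leviCivita S.coneMetric (coneLift Y b) p v =
      tangentInl p (leviCivita S.g Y p.1 (tangentFst p v) - tangentSnd p v • Y p.1
          - b • tangentFst p v)
        + (S.g.inner p.1 (tangentFst p v) (Y p.1) - tangentSnd p v * b) • ddt p := by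
  refine eq_of_inner_eq S.coneMetric fun u ↦ ?_
  have ext (w : TangentSpace (I.prod 𝓘(ℝ, ℝ)) p) : ∃ X : Π x : M, TangentSpace I x,
      ContMDiffAt I (I.prod 𝓘(ℝ, E)) ∞ (T% X) p.1 ∧ X p.1 = tangentFst p w ∧
        coneLift X (tangentSnd p w) p = w :=
    ⟨FiberBundle.extend E (tangentFst p w), FiberBundle.contMDiffAt_extend .., by simp,
      by simpa [coneLift] using tangentInl_add_smul_ddt p w⟩
  obtain ⟨X, hX, hXv, hX'⟩ := ext v
  obtain ⟨Z, hZ, hZu, hZ'⟩ := ext u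
  have hd {W : Π x : M, TangentSpace I x} {c : ℝ}
      (hW : ContMDiffAt I (I.prod 𝓘(ℝ, E)) ∞ (T% W) p.1) :
      MDiffAt (T% (coneLift W c)) p := (contMDiffAt_coneLift c hW).mdifferentiableAt (by simp)
  have hX1 := hX.mdifferentiableAt (by simp)
  have hY1 := hY.mdifferentiableAt (by simp)
  have hZ1 := hZ.mdifferentiableAt (by simp)
  have h1 := inner_leviCivitaFun S.coneMetric (hd (c := b) hY) (hd (c := tangentSnd p v) hX)
    (hd (c := tangentSnd p u) hZ)
  have h2 := inner_leviCivitaFun S.g hY1 hX1 hZ1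
  rw [S.koszul_coneMetric_coneLift _ _ _ hX1 hY1 hZ1, hX', hZ', hXv, hZu] at h1
  rw [hXv, hZu] at h2
  refine h1.trans ?_
  change _ = S.coneInner p _ _
  rw [coneInner_apply]
  have h3 : koszul S.g Y X Z p.1 =
      2 * S.g.inner p.1 (leviCivita S.g Y p.1 (tangentFst p v)) (tangentFst p u) := by
    change _ = 2 * S.g.inner p.1 (leviCivitaFun S.g Y p.1 (tangentFst p v)) (tangentFst p u)
    rw [h2]; ring
  rw [h3]
  simp
  ring

end AlmostContactMetricStructure

end ConeConnection

section EndDeriv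

variable {E : Type*} [NormedAddCommGroup E] [NormedSpace ℝ E]
  {H : Type*} [TopologicalSpace H] {I : ModelWithCorners ℝ E H}
  {M : Type*} [TopologicalSpace M] [ChartedSpace H M] [IsManifold I ∞ M]

lemma SmoothEndomorphismField.mdifferentiableAt_apply (A : SmoothEndomorphismField I M) {x : M}
    {Y : Π x : M, TangentSpace I x} (hY : MDiffAt (T% Y) x) :
    MDiffAt (T% (fun y ↦ A y (Y y))) x :=
  MDifferentiableAt.clm_bundle_apply (F₁ := E) (F₂ := E)
    ((A.contMDiff x).mdifferentiableAt (by simp)) hY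

lemma SmoothEndomorphismField.contMDiffAt_apply (A : SmoothEndomorphismField I M) {x : M}
    {Y : Π x : M, TangentSpace I x} (hY : ContMDiffAt I (I.prod 𝓘(ℝ, E)) ∞ (T% Y) x) :
    ContMDiffAt I (I.prod 𝓘(ℝ, E)) ∞ (T% (fun y ↦ A y (Y y))) x :=
  ContMDiffAt.clm_bundle_apply (F₁ := E) (F₂ := E) (A.contMDiff x) hY

lemma SmoothVectorField.mdifferentiableAt (Y : SmoothVectorField I M) (x : M) :
    MDiffAt (T% (fun y ↦ Y y)) x :=
  (Y.contMDiff x).mdifferentiableAt (by simp)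

namespace CovariantDerivative

variable (nabla : CovariantDerivative I E (TangentSpace I : M → Type _))
  (A : SmoothEndomorphismField I M)

lemma apply_add {Y Z : Π x : M, TangentSpace I x} {x : M} (hY : MDiffAt (T% Y) x)
    (hZ : MDiffAt (T% Z) x) : nabla (Y + Z) x = nabla Y x + nabla Z x :=
  nabla.isCovariantDerivativeOnUniv.add hY hZ

lemma apply_smul {f : M → ℝ} {Y : Π x : M, TangentSpace I x} {x : M} (hY : MDiffAt (T% Y) x)
    (hf : MDiffAt f x) (v : TangentSpace I x) :
    nabla (f • Y) x v = f x • nabla Y x v + d% f x v • Y x := by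
  rw [nabla.isCovariantDerivativeOnUniv.leibniz hY hf]
  rfl

lemma apply_const_smul (c : ℝ) {Y : Π x : M, TangentSpace I x} {x : M} (hY : MDiffAt (T% Y) x)
    (v : TangentSpace I x) :
    nabla (c • Y) x v = c • nabla Y x v := by
  have := nabla.apply_smul hY (f := fun _ ↦ c) mdifferentiableAt_const v
  rw [mvfderiv_const] at this
  refine this.trans ?_
  simp

lemma tensorialAt_endDeriv (x : M) :
    TensorialAt I E (fun Y : Π x : M, TangentSpace I x ↦
      (nabla (fun y ↦ A y (Y y)) x - A x ∘L nabla Y x : TangentSpace I x →L[ℝ] TangentSpace I x))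
      x where
  smul {f Y} hf hY := by
    ext v
    have h : (fun y ↦ A y ((f • Y) y)) = f • fun y ↦ A y (Y y) := by
      ext y
      simp
    rw [h]
    simp [apply_smul nabla hY hf, apply_smul nabla (A.mdifferentiableAt_apply hY) hf, smul_sub]
  add {Y Z} hY hZ := by
    have h : (fun y ↦ A y ((Y + Z) y)) = (fun y ↦ A y (Y y)) + fun y ↦ A y (Z y) := by
      ext y
      simp
    rw [h, apply_add nabla hY hZ,
      apply_add nabla (A.mdifferentiableAt_apply hY) (A.mdifferentiableAt_apply hZ)]
    ext v
    simp
    abel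

variable [FiniteDimensional ℝ E]

/-- The covariant derivative of a field of endomorphisms: `nabla.endDeriv A x w v` is
`(∇_v A) w` at `x`. -/
def endDeriv (x : M) : TangentSpace I x →L[ℝ] TangentSpace I x →L[ℝ] TangentSpace I x :=
  TensorialAt.mkHom _ x (nabla.tensorialAt_endDeriv A x)

lemma endDeriv_apply {Y : Π x : M, TangentSpace I x} {x : M} (hY : MDiffAt (T% Y) x)
    (v : TangentSpace I x) :
    nabla.endDeriv A x (Y x) v = nabla (fun y ↦ A y (Y y)) x v - A x (nabla Y x v) := by
  rw [endDeriv, TensorialAt.mkHom_apply _ hY]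
  rfl

lemma covEnd_eq_endDeriv (X : Π x : M, TangentSpace I x) {Y : Π x : M, TangentSpace I x} {x : M}
    (hY : MDiffAt (T% Y) x) :
    nabla.covEnd A X Y x = nabla.endDeriv A x (Y x) (X x) :=
  (nabla.endDeriv_apply A hY _).symm

end CovariantDerivative

variable [FiniteDimensional ℝ E]

/-- Every tangent vector of a Hausdorff manifold is a value of a smooth vector field. -/
lemma SmoothVectorField.exists_apply_eq [T2Space M] {x : M} (v : TangentSpace I x) :
    ∃ X : SmoothVectorField I M, X x = v := by
  obtain ⟨s, hs, hsσ⟩ := FiberBundle.exists_contMDiffOn_extend (k := ∞) I E v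
  obtain ⟨u, hus, hu, hxu⟩ := mem_nhds_iff.1 hs
  obtain ⟨f, hf, -⟩ := (SmoothBumpFunction.nhds_basis_support (I := I) (hu.mem_nhds hxu)).mem_iff.1
    Filter.univ_mem
  refine ⟨⟨⇑f • FiberBundle.extend E v, ?_⟩, ?_⟩
  · exact ContMDiffOn.smul_section_of_tsupport f.contMDiff.contMDiffOn hu hf (hsσ.mono hus)
  · change f x • FiberBundle.extend E v x = v
    simp

namespace AlmostHermitianStructure

variable (S : AlmostHermitianStructure I M)

lemma isQuasiKahler_iff [T2Space M] :
    S.IsQuasiKahler ↔ ∀ (x : M) (v w : TangentSpace I x),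
      (leviCivita S.g).endDeriv S.J x w v + (leviCivita S.g).endDeriv S.J x (S.J x w) (S.J x v) = 0
      := by
  have key (X Y : SmoothVectorField I M) (x : M) :
      (leviCivita S.g).covEnd S.J X Y x
        + (leviCivita S.g).covEnd S.J (fun y ↦ S.J y (X y)) (fun y ↦ S.J y (Y y)) x =
      (leviCivita S.g).endDeriv S.J x (Y x) (X x)
        + (leviCivita S.g).endDeriv S.J x (S.J x (Y x)) (S.J x (X x)) := by
    rw [CovariantDerivative.covEnd_eq_endDeriv _ _ _ (Y.mdifferentiableAt x),
      CovariantDerivative.covEnd_eq_endDeriv _ _ _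
        (S.J.mdifferentiableAt_apply (Y.mdifferentiableAt x))]
  refine ⟨fun h x v w ↦ ?_, fun h X Y x ↦ (key X Y x).trans (h x _ _)⟩
  obtain ⟨X, rfl⟩ := SmoothVectorField.exists_apply_eq v
  obtain ⟨Y, rfl⟩ := SmoothVectorField.exists_apply_eq w
  exact (key X Y x).symm.trans (h X Y x)

lemma endDeriv_J (x : M) (v w : TangentSpace I x) :
    (leviCivita S.g).endDeriv S.J x (S.J x w) v = -S.J x ((leviCivita S.g).endDeriv S.J x w v) := by
  obtain ⟨Y, hY, rfl⟩ : ∃ Y : Π x : M, TangentSpace I x, MDiffAt (T% Y) x ∧ Y x = w :=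
    ⟨FiberBundle.extend E w, FiberBundle.mdifferentiableAt_extend .., by simp⟩
  rw [CovariantDerivative.endDeriv_apply _ _ hY,
    CovariantDerivative.endDeriv_apply _ _ (S.J.mdifferentiableAt_apply hY)]
  have h : (fun y ↦ S.J y (S.J y (Y y))) = (-1 : ℝ) • Y := by
    ext y
    simp [S.J_J]
  rw [h, CovariantDerivative.apply_const_smul _ _ hY, map_sub, S.J_J]
  simp
  abel

end AlmostHermitianStructure

end EndDeriv

section QuasiContact

variable {E : Type*} [NormedAddCommGroup E] [NormedSpace ℝ E]
  {H : Type*} [TopologicalSpace H] {I : ModelWithCorners ℝ E H}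
  {M : Type*} [TopologicalSpace M] [ChartedSpace H M] [IsManifold I ∞ M]

namespace AlmostContactMetricStructure

variable (S : AlmostContactMetricStructure I M)

lemma inner_φ_left (x : M) (u v : TangentSpace I x) :
    S.g.inner x (S.φ x u) v = -S.g.inner x u (S.φ x v) := by
  have h := S.g_φ_φ x u (S.φ x v)
  rw [S.φ_φ, S.η_φ, map_add, map_neg, map_smul, S.g.symm x _ (S.ξ x), ← S.η_eq, S.η_φ] at h
  simp at h
  linarith

variable [FiniteDimensional ℝ E]

lemma endDeriv_ξ (x : M) (u : TangentSpace I x) :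
    (leviCivita S.g).endDeriv S.φ x (S.ξ x) u = -S.φ x (leviCivita S.g S.ξ x u) := by
  rw [CovariantDerivative.endDeriv_apply _ _ (S.ξ.mdifferentiableAt x)]
  have h : (fun y ↦ S.φ y (S.ξ y)) = 0 := funext S.φ_ξ
  rw [h, CovariantDerivative.zero]
  simp

lemma inner_leviCivita_ξ_ξ (x : M) (u : TangentSpace I x) :
    S.g.inner x (leviCivita S.g S.ξ x u) (S.ξ x) = 0 := by
  have h := (isLeviCivita_leviCivita S.g).metric (S.ξ.mdifferentiableAt x)
    (S.ξ.mdifferentiableAt x) u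
  have h1 : (fun y ↦ S.g.inner y (S.ξ y) (S.ξ y)) = fun _ ↦ (1 : ℝ) := by
    ext y
    rw [← S.η_eq, S.η_ξ]
  rw [h1, mvfderiv_const, S.g.symm x (S.ξ x)] at h
  simp only [zero_apply] at h
  linarith

lemma η_leviCivita_ξ (x : M) (u : TangentSpace I x) :
    (S.η x (leviCivita S.g S.ξ x u) : ℝ) = 0 := by
  rw [S.η_eq, S.g.symm, S.inner_leviCivita_ξ_ξ]

/-- `h X = ½ ((∇_ξ φ) X - ∇_{φ X} ξ + φ (∇_X ξ))`. -/
lemma h_eq {X : Π x : M, TangentSpace I x} {x : M} (hX : MDiffAt (T% X) x) :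
    S.h X x = (2⁻¹ : ℝ) • ((leviCivita S.g).endDeriv S.φ x (X x) (S.ξ x)
      - leviCivita S.g S.ξ x (S.φ x (X x)) + S.φ x (leviCivita S.g S.ξ x (X x))) := by
  have ht {Y Z : Π x : M, TangentSpace I x} :=
    (leviCivita S.g).torsion_eq_zero_iff.1 (isLeviCivita_leviCivita S.g).torsion_eq_zero
      (X := Y) (Y := Z) (x := x)
  have h1 := ht (S.ξ.mdifferentiableAt x) (S.φ.mdifferentiableAt_apply hX)
  have h2 := ht (S.ξ.mdifferentiableAt x) hX
  rw [h, ← h1, ← h2, CovariantDerivative.endDeriv_apply _ _ hX, map_sub]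
  congr 1
  abel

/-- `(∇̄_v J̄) ∂/∂t = ∇_u ξ + φ u`, where `u` is the component of `v` tangent to `M`. -/
lemma cone_endDeriv_ddt (p : M × ℝ) (v : TangentSpace (I.prod 𝓘(ℝ, ℝ)) p) :
    (leviCivita S.cone.g).endDeriv S.cone.J p (ddt p) v =
      tangentInl p (leviCivita S.g S.ξ p.1 (tangentFst p v) + S.φ p.1 (tangentFst p v)) := by
  have h0 : (ddt : Π p : M × ℝ, TangentSpace (I.prod 𝓘(ℝ, ℝ)) p) = coneLift 0 1 := by
    ext q
    simp [coneLift]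
  have hz : ContMDiffAt I (I.prod 𝓘(ℝ, E)) ∞ (T% (0 : Π x : M, TangentSpace I x)) p.1 :=
    (contMDiff_zeroSection ℝ (TangentSpace I : M → Type _)).contMDiffAt
  have h1 := (leviCivita S.cone.g).endDeriv_apply S.cone.J
    ((contMDiffAt_coneLift 1 hz).mdifferentiableAt (by simp)) v
  have h2 : (fun q ↦ S.cone.J q (coneLift (0 : Π x : M, TangentSpace I x) 1 q)) =
      coneLift S.ξ 0 := by
    ext q
    change S.coneJFun q _ = _
    simp [coneJFun_apply, coneLift]
  rw [h2] at h1
  rw [h0, h1]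
  change leviCivita S.coneMetric _ p v - S.coneJFun p (leviCivita S.coneMetric _ p v) = _
  rw [S.leviCivita_coneMetric_coneLift _ (S.ξ.contMDiff p.1),
    S.leviCivita_coneMetric_coneLift _ hz, CovariantDerivative.zero]
  have h3 : (S.η p.1 (tangentFst p v) : ℝ) = S.g.inner p.1 (tangentFst p v) (S.ξ p.1) := by
    rw [S.η_eq, S.g.symm]
  simp [coneJFun_apply, h3]
  module

/-- The covariant derivative of `J̄` on the vectors tangent to `M`. -/
lemma cone_endDeriv_inl (p : M × ℝ) (y : TangentSpace I p.1)
    (v : TangentSpace (I.prod 𝓘(ℝ, ℝ)) p) :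
    (leviCivita S.cone.g).endDeriv S.cone.J p (tangentInl p y) v =
      tangentInl p ((leviCivita S.g).endDeriv S.φ p.1 y (tangentFst p v)
        + (S.η p.1 y : ℝ) • tangentFst p v - S.g.inner p.1 (tangentFst p v) y • S.ξ p.1)
      + (S.g.inner p.1 (tangentFst p v) (S.φ p.1 y)
        - S.g.inner p.1 (leviCivita S.g S.ξ p.1 (tangentFst p v)) y) • ddt p := by
  obtain ⟨Y, hY, rfl⟩ : ∃ Y : Π x : M, TangentSpace I x,
      ContMDiffAt I (I.prod 𝓘(ℝ, E)) ∞ (T% Y) p.1 ∧ Y p.1 = y :=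
    ⟨FiberBundle.extend E y, FiberBundle.contMDiffAt_extend .., by simp⟩
  have hY1 := hY.mdifferentiableAt (by simp)
  have hφ := S.φ.contMDiffAt_apply hY
  have hz : ContMDiffAt I (I.prod 𝓘(ℝ, E)) ∞ (T% (0 : Π x : M, TangentSpace I x)) p.1 :=
    (contMDiff_zeroSection ℝ (TangentSpace I : M → Type _)).contMDiffAt
  have h0 : tangentInl p (Y p.1) = coneLift Y 0 p := by simp [coneLift]
  have h1 := (leviCivita S.cone.g).endDeriv_apply S.cone.J
    ((contMDiffAt_coneLift 0 hY).mdifferentiableAt (by simp)) v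
  have h2 : (fun q ↦ S.cone.J q (coneLift Y 0 q)) =
      coneLift (fun y ↦ S.φ y (Y y)) 0 + (-(fun q : M × ℝ ↦ S.g.inner q.1 (S.ξ q.1) (Y q.1))) •
        coneLift (0 : Π x : M, TangentSpace I x) 1 := by
    ext q
    change S.coneJFun q _ = _
    simp [coneJFun_apply, coneLift, S.η_eq]
    module
  have hη0 := mdifferentiableAt_metric S.g (S.ξ.mdifferentiableAt p.1) hY1
  have hη : MDiffAt (fun q : M × ℝ ↦ S.g.inner q.1 (S.ξ q.1) (Y q.1)) p :=
    hη0.comp p mdifferentiableAt_fst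
  have hl : MDiffAt (T% (coneLift (0 : Π x : M, TangentSpace I x) 1)) p :=
    (contMDiffAt_coneLift 1 hz).mdifferentiableAt (by simp)
  rw [h2, CovariantDerivative.apply_add _ ((contMDiffAt_coneLift 0 hφ).mdifferentiableAt (by simp))
    (hη.neg.smul_section hl), add_apply, CovariantDerivative.apply_smul _ hl hη.neg, mvfderiv_neg,
    neg_apply, mvfderiv_comp_fst hη0,
    (isLeviCivita_leviCivita S.g).metric (S.ξ.mdifferentiableAt p.1) hY1] at h1
  rw [h0, h1, CovariantDerivative.endDeriv_apply _ _ hY1]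
  change leviCivita S.coneMetric _ p v + (_ • leviCivita S.coneMetric _ p v + _)
    - S.coneJFun p (leviCivita S.coneMetric _ p v) = _
  rw [S.leviCivita_coneMetric_coneLift _ hφ, S.leviCivita_coneMetric_coneLift _ hz,
    S.leviCivita_coneMetric_coneLift _ hY, CovariantDerivative.zero]
  simp [coneJFun_apply, coneLift, S.η_eq]
  module

end AlmostContactMetricStructure

end QuasiContact

section Characterization

variable {E : Type*} [NormedAddCommGroup E] [NormedSpace ℝ E] [FiniteDimensional ℝ E]
  {H : Type*} [TopologicalSpace H] {I : ModelWithCorners ℝ E H}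
  {M : Type*} [TopologicalSpace M] [ChartedSpace H M] [IsManifold I ∞ M]

namespace AlmostHermitianStructure

variable (S : AlmostHermitianStructure I M)

/-- The tensor `(∇_v J) w + (∇_{J v} J) (J w)`. -/
def quasiKahlerTensor (x : M) (v w : TangentSpace I x) : TangentSpace I x :=
  (leviCivita S.g).endDeriv S.J x w v + (leviCivita S.g).endDeriv S.J x (S.J x w) (S.J x v)

lemma quasiKahlerTensor_J_left (x : M) (v w : TangentSpace I x) :
    S.quasiKahlerTensor x (S.J x v) w = S.J x (S.quasiKahlerTensor x v w) := by
  simp only [quasiKahlerTensor, endDeriv_J, S.J_J, map_add, map_neg]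
  abel

lemma quasiKahlerTensor_J_right (x : M) (v w : TangentSpace I x) :
    S.quasiKahlerTensor x v (S.J x w) = -S.J x (S.quasiKahlerTensor x v w) := by
  simp only [quasiKahlerTensor, endDeriv_J, S.J_J, map_add, map_neg, neg_apply]
  abel

end AlmostHermitianStructure

namespace AlmostContactMetricStructure

variable (S : AlmostContactMetricStructure I M)

/-- The component of the quasi-Kähler tensor of `M × ℝ` tangent to `M`. -/
def coneTensor (x : M) (u y : TangentSpace I x) : TangentSpace I x :=
  (leviCivita S.g).endDeriv S.φ x y u + (leviCivita S.g).endDeriv S.φ x (S.φ x y) (S.φ x u)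
    + (2 * S.η x y : ℝ) • u - (2 * S.g.inner x u y) • S.ξ x
    - (S.η x y : ℝ) • leviCivita S.g S.ξ x (S.φ x u)

lemma cone_J_inl (p : M × ℝ) (u : TangentSpace I p.1) :
    S.cone.J p (tangentInl p u) = tangentInl p (S.φ p.1 u) - (S.η p.1 u : ℝ) • ddt p := by
  change S.coneJFun p _ = _
  simp [coneJFun_apply]

lemma cone_quasiKahlerTensor_inl (p : M × ℝ) (u y : TangentSpace I p.1) :
    S.cone.quasiKahlerTensor p (tangentInl p u) (tangentInl p y) =
      tangentInl p (S.coneTensor p.1 u y)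
      + (2 * S.g.inner p.1 u (S.φ p.1 y) - S.g.inner p.1 (leviCivita S.g S.ξ p.1 u) y
        - S.g.inner p.1 (leviCivita S.g S.ξ p.1 (S.φ p.1 u)) (S.φ p.1 y)) • ddt p := by
  have h2 : (S.η p.1 (S.φ p.1 y) : ℝ) = 0 := S.η_φ p.1 y
  simp only [AlmostHermitianStructure.quasiKahlerTensor, cone_J_inl, map_sub, map_smul, sub_apply,
    smul_apply, S.cone_endDeriv_inl, S.cone_endDeriv_ddt, h2, tangentFst_inl,
    tangentFst_ddt, smul_zero, sub_zero, map_zero, zero_apply, S.φ_φ, S.φ_ξ, map_neg, map_add, coneTensor,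
    S.g_φ_φ, S.inner_φ_left]
  module

lemma conditionC₁_iff [T2Space M] :
    S.ConditionC₁ ↔ ∀ (x : M) (u y : TangentSpace I x),
      (leviCivita S.g).endDeriv S.φ x y u + (leviCivita S.g).endDeriv S.φ x (S.φ x y) (S.φ x u) =
        (2 * S.g.inner x u y) • S.ξ x - (S.η x y : ℝ) • u
          - ((S.η x u : ℝ) * (S.η x y : ℝ)) • S.ξ x
          - (S.η x y : ℝ) • (2⁻¹ : ℝ) • ((leviCivita S.g).endDeriv S.φ x u (S.ξ x)
            - leviCivita S.g S.ξ x (S.φ x u) + S.φ x (leviCivita S.g S.ξ x u)) := by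
  have key (X Y : SmoothVectorField I M) (x : M) :
      (leviCivita S.g).covEnd S.φ X Y x
        + (leviCivita S.g).covEnd S.φ (fun y ↦ S.φ y (X y)) (fun y ↦ S.φ y (Y y)) x =
      (leviCivita S.g).endDeriv S.φ x (Y x) (X x)
        + (leviCivita S.g).endDeriv S.φ x (S.φ x (Y x)) (S.φ x (X x)) := by
    rw [CovariantDerivative.covEnd_eq_endDeriv _ _ _ (Y.mdifferentiableAt x),
      CovariantDerivative.covEnd_eq_endDeriv _ _ _
        (S.φ.mdifferentiableAt_apply (Y.mdifferentiableAt x))]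
  refine ⟨fun h x u y ↦ ?_, fun h X Y x ↦ ?_⟩
  · obtain ⟨X, rfl⟩ := SmoothVectorField.exists_apply_eq u
    obtain ⟨Y, rfl⟩ := SmoothVectorField.exists_apply_eq y
    rw [← S.h_eq (X.mdifferentiableAt x), ← key]
    exact h X Y x
  · rw [S.h_eq (X.mdifferentiableAt x), key]
    exact h x _ _

/-- The identity `φ (∇_u ξ) + ∇_{φ u} ξ = 2 u - 2 η(u) ξ`. -/
lemma φ_leviCivita_ξ_of_coneTensor {x : M} {u : TangentSpace I x}
    (h : S.coneTensor x u (S.ξ x) = 0) :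
    S.φ x (leviCivita S.g S.ξ x u) + leviCivita S.g S.ξ x (S.φ x u) =
      (2 : ℝ) • u - (2 * S.η x u : ℝ) • S.ξ x := by
  have h1 : (S.η x (S.ξ x) : ℝ) = 1 := S.η_ξ x
  rw [coneTensor, S.φ_ξ, map_zero, zero_apply, h1, S.g.symm, ← S.η_eq, S.endDeriv_ξ] at h
  linear_combination (norm := module) -h

lemma endDeriv_apply_ξ_of_coneTensor {x : M} {y : TangentSpace I x}
    (h : S.coneTensor x (S.ξ x) y = 0) :
    (leviCivita S.g).endDeriv S.φ x y (S.ξ x) = 0 := by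
  rw [coneTensor, S.φ_ξ, map_zero, map_zero, ← S.η_eq] at h
  simpa using h

lemma conditionC₁_iff_coneTensor [T2Space M] :
    S.ConditionC₁ ↔ ∀ (x : M) (u y : TangentSpace I x), S.coneTensor x u y = 0 := by
  rw [conditionC₁_iff]
  refine forall_congr' fun x ↦ ⟨fun h u y ↦ ?_, fun h u y ↦ ?_⟩
  · have h1 : (S.η x (S.ξ x) : ℝ) = 1 := S.η_ξ x
    have h2 (u) : (leviCivita S.g).endDeriv S.φ x u (S.ξ x) = 0 := by
      have h4 := h (S.ξ x) u
      rw [S.endDeriv_ξ, S.φ_ξ, map_zero, map_zero, ← S.η_eq, h1] at h4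
      linear_combination (norm := module) h4
    have h3 := h u (S.ξ x)
    rw [S.φ_ξ, map_zero, zero_apply, h1, S.g.symm, ← S.η_eq, S.endDeriv_ξ, h2] at h3
    rw [coneTensor, h, h2]
    have h4 : S.φ x (leviCivita S.g S.ξ x u) + leviCivita S.g S.ξ x (S.φ x u) =
        (2 : ℝ) • u - (2 * S.η x u : ℝ) • S.ξ x := by
      linear_combination (norm := module) (-2 : ℝ) • h3
    linear_combination (norm := module) (-(S.η x y : ℝ) / 2) • h4
  · have h1 := S.φ_leviCivita_ξ_of_coneTensor (h u (S.ξ x))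
    rw [S.endDeriv_apply_ξ_of_coneTensor (h (S.ξ x) u)]
    have h2 := h u y
    rw [coneTensor] at h2
    linear_combination (norm := module) h2 + ((S.η x y : ℝ) / 2) • h1

lemma inner_leviCivita_ξ_of_coneTensor {x : M} {u : TangentSpace I x}
    (h : S.coneTensor x u (S.ξ x) = 0) (y : TangentSpace I x) :
    2 * S.g.inner x u (S.φ x y) - S.g.inner x (leviCivita S.g S.ξ x u) y
      - S.g.inner x (leviCivita S.g S.ξ x (S.φ x u)) (S.φ x y) = 0 := by
  have h1 := congrArg (fun v ↦ S.g.inner x v (S.φ x y)) (S.φ_leviCivita_ξ_of_coneTensor h)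
  have h2 : S.g.inner x (S.ξ x) (S.φ x y) = 0 := by rw [← S.η_eq, S.η_φ]
  have h3 := S.g_φ_φ x (leviCivita S.g S.ξ x u) y
  rw [S.η_leviCivita_ξ, zero_mul, sub_zero] at h3
  simp only [map_add, add_apply, map_sub, sub_apply, map_smul, smul_apply, smul_eq_mul, h2, h3]
    at h1
  linarith

lemma isQuasiContactMetric_iff_coneTensor [T2Space M] :
    S.IsQuasiContactMetric ↔ ∀ (x : M) (u y : TangentSpace I x), S.coneTensor x u y = 0 := by
  refine S.cone.isQuasiKahler_iff.trans ⟨fun h x u y ↦ ?_, fun h p v w ↦ ?_⟩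
  · have key (p : M × ℝ) (u y : TangentSpace I p.1) : S.coneTensor p.1 u y = 0 := by
      have h2 := congrArg (tangentFst p)
        ((S.cone_quasiKahlerTensor_inl p u y).symm.trans (h p _ _))
      simpa using h2
    exact key (x, 0) u y
  · have h0 (u y : TangentSpace I p.1) :
        S.cone.quasiKahlerTensor p (tangentInl p u) (tangentInl p y) = 0 := by
      rw [S.cone_quasiKahlerTensor_inl, h, S.inner_leviCivita_ξ_of_coneTensor (h _ _ _)]
      simp
    have hJ : ddt p = S.cone.J p (-tangentInl p (S.ξ p.1)) := by
      have h1 : (S.η p.1 (S.ξ p.1) : ℝ) = 1 := S.η_ξ p.1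
      rw [map_neg, cone_J_inl, S.φ_ξ, h1]
      simp
    have hadd (v v' w w' : TangentSpace (I.prod 𝓘(ℝ, ℝ)) p) (a b : ℝ) :
        S.cone.quasiKahlerTensor p (v + a • v') (w + b • w') =
          S.cone.quasiKahlerTensor p v w + a • S.cone.quasiKahlerTensor p v' w
          + b • S.cone.quasiKahlerTensor p v w' + (a * b) • S.cone.quasiKahlerTensor p v' w' := by
      simp only [AlmostHermitianStructure.quasiKahlerTensor, map_add, map_smul, add_apply,
        smul_apply]
      module
    change S.cone.quasiKahlerTensor p v w = 0
    rw [← tangentInl_add_smul_ddt p v, ← tangentInl_add_smul_ddt p w, hadd, hJ, ← map_neg]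
    simp only [AlmostHermitianStructure.quasiKahlerTensor_J_left,
      AlmostHermitianStructure.quasiKahlerTensor_J_right, h0]
    simp

end AlmostContactMetricStructure

end Characterization

end

theorem theorem4p2 {E : Type*} [NormedAddCommGroup E] [NormedSpace ℝ E] [FiniteDimensional ℝ E]
    {H : Type*} [TopologicalSpace H] {I : ModelWithCorners ℝ E H}
    {M : Type*} [TopologicalSpace M] [ChartedSpace H M] [IsManifold I ∞ M]
    [BoundarylessManifold I M] [T2Space M]
    (S : AlmostContactMetricStructure I M) :
    S.IsQuasiContactMetric ↔ S.ConditionC₁ := by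
  rw [S.isQuasiContactMetric_iff_coneTensor, S.conditionC₁_iff_coneTensor]
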